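/- Let $\mathbb{K}$ be a field, let $G$ be a finite simple graph with vertices $v_1,\dots,v_n$, let $S=\mathbb{K}[x_1,\dots,x_n]$, and let $I=I(G)=(x_ix_j : \{v_i,v_j\}\in E(G))\subseteq S$ be its edge ideal. Let $p$ be the number of connected components of $G$ that are bipartite (an isolated vertex counts as a bipartite component). Then for every integer $k\ge 0$, $$\operatorname{sdepth}\bigl(\overline{I^k}/\overline{I^{k+1}}\bigr)\ \ge\ p .$$ Here $\overline{J}$ denotes the integral closure of an ideal $J\subseteq S$, i.e. the ideal of all $f\in S$ satisfying an equation $f^d+c_1f^{d-1}+\dots+c_d=0$ with $d\ge 1$ and $c_i\in J^i$. For a finitely generated $\mathbb{Z}^n$-graded $S$-module $M$, a Stanley space of $M$ of dimension $|Z|$ is a $\mathbb{K}$-subspace $u\,\mathbb{K}[Z]$ with $u\in M$ a nonzero homogeneous element and $Z\subseteq\{x_1,\dots,x_n\}$ such that $u\,\mathbb{K}[Z]$ is a free $\mathbb{K}[Z]$-module; a Stanley decomposition of $M$ is a decomposition of $M$, as a $\mathbb{K}$-vector space, into a finite direct sum of Stanley spaces; and $\operatorname{sdepth}(M)$ is the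 maximum, over all Stanley decompositions of $M$, of the minimum dimension of a Stanley space in the decomposition, with $\operatorname{sdepth}(0)=\infty$. The module $\overline{I^k}/\overline{I^{k+1}}$ carries the $\mathbb{Z}^n$-grading induced by the exponents of monomials. -/

import Mathlib

/-! ### Integral closure of an ideal -/

section IntegralClosure

variable {R : Type*} [CommRing R]

/-- `f` is integral over the ideal `I`: there is an equation
`f ^ d + c₁ f ^ (d - 1) + ⋯ + c_d = 0` with `d ≥ 1` and `c_i ∈ I ^ i`. -/
def IsIntegralOverIdeal (I : Ideal R) (f : R) : Prop :=
  ∃ d : ℕ, 0 < d ∧ ∃ c : ℕ → R, (∀ i ∈ Finset.Icc 1 d, c i ∈ I ^ i) ∧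
    f ^ d + ∑ i ∈ Finset.Icc 1 d, c i * f ^ (d - i) = 0

/-- `f` is integral over `I` exactly when `f T` is integral over the Rees algebra `R[I T]`. This is
used to show that the elements integral over `I` form an ideal. -/
theorem isIntegralOverIdeal_iff (I : Ideal R) (f : R) :
    IsIntegralOverIdeal I f ↔ IsIntegral (reesAlgebra I) (Polynomial.monomial 1 f) := by
  constructor
  · rintro ⟨d, hd, c, hc, h⟩
    have hmem : ∀ i, i ∈ Finset.Icc 1 d → Polynomial.monomial i (c i) ∈ reesAlgebra I :=
      fun i hi => reesAlgebra.monomial_mem.2 (hc i hi)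
    let q : Polynomial (reesAlgebra I) :=
      ∑ i ∈ (Finset.Icc 1 d).attach,
        Polynomial.C ⟨Polynomial.monomial i.1 (c i.1), hmem i.1 i.2⟩ * Polynomial.X ^ (d - i.1)
    refine ⟨Polynomial.X ^ d + q, ?_, ?_⟩
    · apply Polynomial.monic_X_pow_add
      refine Polynomial.mem_degreeLT.1 (Submodule.sum_mem _ ?_)
      rintro ⟨i, hi⟩ -
      rw [Polynomial.mem_degreeLT]
      refine (Polynomial.degree_C_mul_X_pow_le _ _).trans_lt ?_
      rw [Finset.mem_Icc] at hi
      exact_mod_cast (by omega : d - i < d)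
    · have hq : Polynomial.eval₂ (algebraMap (reesAlgebra I) (Polynomial R))
          (Polynomial.monomial 1 f) q
          = ∑ i ∈ Finset.Icc 1 d, Polynomial.monomial d (c i * f ^ (d - i)) := by
        rw [← Finset.sum_attach]
        simp only [q, Polynomial.eval₂_finsetSum, Polynomial.eval₂_mul, Polynomial.eval₂_C,
          Polynomial.eval₂_X_pow]
        refine Finset.sum_congr rfl ?_
        rintro ⟨i, hi⟩ -
        rw [Finset.mem_Icc] at hi
        change Polynomial.monomial i (c i) * _ = _
        rw [Polynomial.monomial_pow, Polynomial.monomial_mul_monomial, one_mul,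
          Nat.add_sub_cancel' hi.2]
      rw [Polynomial.eval₂_add, hq, Polynomial.eval₂_X_pow, Polynomial.monomial_pow, one_mul,
        ← map_sum, ← map_add, h, map_zero]
  · rintro ⟨p, hp, h⟩
    rcases subsingleton_or_nontrivial R with hR | hR
    · exact ⟨1, one_pos, fun _ => 0, fun i _ => Ideal.zero_mem _, Subsingleton.elim _ _⟩
    have hd : 0 < p.natDegree := by
      rw [Nat.pos_iff_ne_zero]
      intro h0
      rw [hp.natDegree_eq_zero.1 h0] at h
      simp at h
    refine ⟨p.natDegree, hd, fun i => (p.coeff (p.natDegree - i) : Polynomial R).coeff i,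
      fun i _ => (p.coeff (p.natDegree - i)).2 i, ?_⟩
    have h' := congrArg (fun g => Polynomial.coeff g p.natDegree) h
    simp only [Polynomial.coeff_zero] at h'
    rw [Polynomial.eval₂_eq_sum_range, Polynomial.finsetSum_coeff, Finset.sum_range_succ] at h'
    rw [← h', add_comm]
    congr 1
    · refine Finset.sum_bij' (fun i _ => p.natDegree - i) (fun j _ => p.natDegree - j) ?_ ?_ ?_ ?_ ?_
      · intro i hi; rw [Finset.mem_Icc] at hi; rw [Finset.mem_range]; omega
      · intro i hi; rw [Finset.mem_range] at hi; rw [Finset.mem_Icc]; omega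
      · intro i hi; rw [Finset.mem_Icc] at hi; omega
      · intro i hi; rw [Finset.mem_range] at hi; omega
      · intro i hi
        rw [Finset.mem_Icc] at hi
        rw [Polynomial.monomial_pow, one_mul]
        have := Polynomial.coeff_mul_monomial (p.coeff (p.natDegree - i) : Polynomial R)
          (p.natDegree - i) i (f ^ (p.natDegree - i))
        rw [show i + (p.natDegree - i) = p.natDegree by omega] at this
        exact this.symm
    · rw [hp.coeff_natDegree, map_one, one_mul, Polynomial.monomial_pow, one_mul,
        Polynomial.coeff_monomial_same]

/-- The integral closure of the ideal `I`: the ideal of all elements integral over `I`. -/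
def idealIntegralClosure (I : Ideal R) : Ideal R where
  carrier := {f | IsIntegralOverIdeal I f}
  zero_mem' := by
    rw [Set.mem_ofPred_eq, isIntegralOverIdeal_iff, map_zero]
    exact isIntegral_zero
  add_mem' := by
    intro f g hf hg
    rw [Set.mem_ofPred_eq, isIntegralOverIdeal_iff] at *
    rw [map_add]
    exact hf.add hg
  smul_mem' := by
    intro r f hf
    rw [Set.mem_ofPred_eq, isIntegralOverIdeal_iff] at *
    have := (isIntegral_algebraMap (R := reesAlgebra I) (A := Polynomial R)
      (x := algebraMap R (reesAlgebra I) r)).mul hf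
    have e : (Polynomial.monomial 1 (r • f) : Polynomial R)
        = algebraMap (reesAlgebra I) (Polynomial R) (algebraMap R (reesAlgebra I) r)
          * Polynomial.monomial 1 f := by
      change _ = Polynomial.C r * _
      rw [Polynomial.C_mul_monomial, smul_eq_mul]
    rwa [e]

end IntegralClosure

/-! ### Stanley depth of multigraded modules -/

section StanleyDepth

/-- The subspace `u 𝕂[Z]` of a module `M` over `S = 𝕂[x_i : i ∈ σ]`, that is, the
`𝕂[Z]`-submodule of `M` generated by `u`. -/
noncomputable def stanleySpace {σ K M : Type*} [Field K] [AddCommGroup M] [Module (MvPolynomial σ K) M]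
    (u : M) (Z : Finset σ) : Submodule (MvPolynomial.supported K (Z : Set σ)) M :=
  Submodule.span (MvPolynomial.supported K (Z : Set σ)) {u}

/-- `u 𝕂[Z]` is a Stanley space of the `ℤ^σ`-graded module `M` with homogeneous components `ℳ a`:
the element `u` is homogeneous and nonzero, and `u 𝕂[Z]` is a free `𝕂[Z]`-module. -/
structure IsStanleySpace {σ K M : Type*} [Field K] [AddCommGroup M] [Module K M]
    [Module (MvPolynomial σ K) M] (ℳ : (σ → ℤ) → Submodule K M) (u : M) (Z : Finset σ) : Prop where
  homogeneous : ∃ a, u ∈ ℳ a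
  ne_zero : u ≠ 0
  free : Module.Free (MvPolynomial.supported K (Z : Set σ)) (stanleySpace (K := K) u Z)

/-- A Stanley decomposition of the `ℤ^σ`-graded module `M` with homogeneous components `ℳ a`:
finitely many Stanley spaces whose internal direct sum, as `𝕂`-vector spaces, is `M`. -/
structure StanleyDecomposition {σ K M : Type*} [Field K] [AddCommGroup M] [Module K M]
    [Module (MvPolynomial σ K) M] [IsScalarTower K (MvPolynomial σ K) M]
    (ℳ : (σ → ℤ) → Submodule K M) where
  /-- number of Stanley spaces -/
  length : ℕ
  /-- generators of the Stanley spaces -/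
  gen : Fin length → M
  /-- sets of variables of the Stanley spaces -/
  vars : Fin length → Finset σ
  isStanleySpace : ∀ j, IsStanleySpace ℳ (gen j) (vars j)
  isInternal : DirectSum.IsInternal
    (fun j => (stanleySpace (K := K) (gen j) (vars j)).restrictScalars K)

/-- The Stanley depth of a Stanley decomposition: the minimum of the dimensions `|Z|` of its Stanley
spaces (`⊤` for the empty decomposition, which exists only for the zero module). -/
noncomputable def StanleyDecomposition.sdepth {σ K M : Type*} [Field K] [AddCommGroup M]
    [Module K M] [Module (MvPolynomial σ K) M] [IsScalarTower K (MvPolynomial σ K) M]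
    {ℳ : (σ → ℤ) → Submodule K M} (D : StanleyDecomposition ℳ) : ℕ∞ :=
  ⨅ j, ((D.vars j).card : ℕ∞)

/-- The Stanley depth of the `ℤ^σ`-graded module `M` with homogeneous components `ℳ a`: the maximum
of `sdepth D` over all Stanley decompositions `D`. It is `⊤` for the zero module. -/
noncomputable def stanleyDepth {σ K M : Type*} [Field K] [AddCommGroup M] [Module K M]
    [Module (MvPolynomial σ K) M] [IsScalarTower K (MvPolynomial σ K) M]
    (ℳ : (σ → ℤ) → Submodule K M) : ℕ∞ :=
  ⨆ D : StanleyDecomposition ℳ, D.sdepth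

/-- For monomial ideals `J ⊆ I` of `S = 𝕂[x_i : i ∈ σ]`, the component of degree `a ∈ ℤ^σ` of the
module `I / J`: the classes of those `f ∈ I` all of whose monomials have exponent vector `a`. -/
noncomputable def quotientComponent {σ K : Type*} [Field K] (I J : Ideal (MvPolynomial σ K))
    (a : σ → ℤ) : Submodule K (I ⧸ J.submoduleOf I) :=
  Submodule.map ((J.submoduleOf I).mkQ.restrictScalars K)
    { carrier := {f : I | ∀ m ∈ (f : MvPolynomial σ K).support, ∀ i, (m i : ℤ) = a i}
      zero_mem' := by simp
      add_mem' := by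
        classical
        intro f g hf hg m hm
        rcases Finset.mem_union.1 (MvPolynomial.support_add hm) with h | h
        · exact hf m h
        · exact hg m h
      smul_mem' := by
        intro c f hf m hm
        exact hf m (MvPolynomial.support_smul hm) }

end StanleyDepth

/-! ### Edge ideals -/

/-- The edge ideal `I(G) = (x_v x_w : {v, w} ∈ E(G))` in `𝕂[x_v : v ∈ V]`. -/
noncomputable def edgeIdeal (K : Type*) [Field K] {V : Type*} (G : SimpleGraph V) :
    Ideal (MvPolynomial V K) :=
  Ideal.span {f | ∃ v w, G.Adj v w ∧ f = MvPolynomial.X v * MvPolynomial.X w}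

/-- The number of bipartite connected components of `G` (isolated vertices are such components). -/
noncomputable def numBipartiteComponents {V : Type*} (G : SimpleGraph V) : ℕ :=
  Nat.card {C : G.ConnectedComponent // C.toSimpleGraph.IsBipartite}

/-!
The exponent vectors of `closure (I ^ k)` are described by vertex covers: `x ^ a` lies in it iff
`2 * k ≤ ∑ v, h v * a v` for every doubled half-integral vertex cover `h` of `G`
(`mem_idealIntegralClosure_iff`). Necessity is seen on the order of vanishing at `T = 0` after the
substitution `x_v ↦ x_v T ^ h v`; sufficiency follows from Hall's theorem, applied to the bipartite
double cover of `G`, which gives `x ^ (2 a) ∈ I ^ (2 k)`. So the monomials of the quotient are those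
`a` for which `minCover G univ a`, the least weight of such a cover, is `2 * k` or `2 * k + 1`.

The least weight is the sum of its values on the connected components. On a bipartite component
there is always an optimal cover that vanishes at some vertex: move a constant from one colour class
to the other, in the direction that does not increase the weight, until a value reaches zero
(`exists_isSlack`). The exponent of such a slack vertex can grow without changing the minimum. Choose
the first slack vertex `s` in each bipartite component. Raising the exponent of `s` creates no new
slack vertex, so `s` remains the first one, and the least exponent of `s` for which it is the first
one is the start of a ray. The other exponents only matter up to truncation at `2 * (k + 1)`. This
partitions the monomials of the quotient into finitely many cells `c + ℕ^Z`, with at least one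
element of `Z` in each bipartite component (`exists_cell_partition`), and such a partition is a
Stanley decomposition (`le_stanleyDepth_of_partition`).
-/

/-! ### Vertex covers with half-integral weights -/

/-- A half-integral vertex cover with all weights doubled, so that they are natural numbers: the two
ends of each edge have total weight at least `2`. -/
def IsTwoCover {V : Type*} (G : SimpleGraph V) (h : V → ℕ) : Prop :=
  ∀ v w, G.Adj v w → 2 ≤ h v + h w

/-- The least value of `∑ v ∈ U, h v * a v` over all doubled half-integral vertex covers `h` of `G`;
for `U` the whole vertex set, it is twice the fractional matching number of `G` with vertex
capacities `a`. -/
noncomputable def minCover {V : Type*} (G : SimpleGraph V) (U : Finset V) (a : V → ℕ) : ℕ :=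
  sInf {s | ∃ h, IsTwoCover G h ∧ ∑ v ∈ U, h v * a v = s}

/-- Some optimal cover for the weights `a` on `U` vanishes at `s`, so that `a s` may be increased
without changing `minCover G U a`. -/
def IsSlack {V : Type*} (G : SimpleGraph V) (U : Finset V) (a : V → ℕ) (s : V) : Prop :=
  ∃ h, IsTwoCover G h ∧ ∑ v ∈ U, h v * a v = minCover G U a ∧ h s = 0

section Covers

variable {V : Type*} {G : SimpleGraph V} {U : Finset V} {a b : V → ℕ} {N : ℕ}

theorem minCover_le {h : V → ℕ} (hh : IsTwoCover G h) (U : Finset V) (a : V → ℕ) :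
    minCover G U a ≤ ∑ v ∈ U, h v * a v :=
  Nat.sInf_le ⟨h, hh, rfl⟩

theorem exists_sum_eq_minCover (G : SimpleGraph V) (U : Finset V) (a : V → ℕ) :
    ∃ h, IsTwoCover G h ∧ ∑ v ∈ U, h v * a v = minCover G U a :=
  Nat.sInf_mem (s := {s | ∃ h, IsTwoCover G h ∧ ∑ v ∈ U, h v * a v = s})
    ⟨_, fun _ => 1, fun _ _ _ => le_rfl, rfl⟩

theorem minCover_mono (h : ∀ v ∈ U, a v ≤ b v) : minCover G U a ≤ minCover G U b := by
  obtain ⟨c, hc, hs⟩ := exists_sum_eq_minCover G U b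
  rw [← hs]
  exact (minCover_le hc U a).trans (Finset.sum_le_sum fun v hv => Nat.mul_le_mul_left _ (h v hv))

theorem le_minCover_iff (n : ℕ) :
    n ≤ minCover G U a ↔ ∀ h, IsTwoCover G h → n ≤ ∑ v ∈ U, h v * a v := by
  constructor
  · exact fun hn h hh => hn.trans (minCover_le hh U a)
  · intro hn
    obtain ⟨c, hc, hs⟩ := exists_sum_eq_minCover G U a
    exact hs ▸ hn c hc

/-- A cover of total weight below `N` vanishes wherever `N ≤ a v`, so it cannot distinguish weights
with the same truncation at `N`. -/
theorem sum_congr_of_min_eq {h : V → ℕ} (hlt : ∑ v ∈ U, h v * a v < N)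
    (hab : ∀ v ∈ U, min (a v) N = min (b v) N) :
    ∑ v ∈ U, h v * b v = ∑ v ∈ U, h v * a v := by
  refine Finset.sum_congr rfl fun v hv => ?_
  rcases Nat.eq_zero_or_pos (h v) with h0 | h0
  · simp [h0]
  · have h1 : h v * a v < N :=
      (Finset.single_le_sum (f := fun v => h v * a v) (fun _ _ => Nat.zero_le _) hv).trans_lt hlt
    have h2 : a v ≤ h v * a v := Nat.le_mul_of_pos_left _ h0
    have := hab v hv
    rw [show b v = a v by omega]

theorem minCover_congr_of_min_eq (hlt : minCover G U a < N)
    (hab : ∀ v ∈ U, min (a v) N = min (b v) N) : minCover G U b = minCover G U a := by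
  obtain ⟨c, hc, hs⟩ := exists_sum_eq_minCover G U a
  have h1 : minCover G U b ≤ minCover G U a := by
    rw [← hs, ← sum_congr_of_min_eq (hs ▸ hlt) hab]
    exact minCover_le hc U b
  obtain ⟨d, hd, ht⟩ := exists_sum_eq_minCover G U b
  refine h1.antisymm ?_
  rw [← ht, ← sum_congr_of_min_eq (ht ▸ h1.trans_lt hlt) fun v hv => (hab v hv).symm]
  exact minCover_le hd U a

theorem IsSlack.of_min_eq {s : V} (h : IsSlack G U a s) (hlt : minCover G U a < N)
    (hab : ∀ v ∈ U, min (a v) N = min (b v) N) : IsSlack G U b s := by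
  obtain ⟨c, hc, hs, h0⟩ := h
  exact ⟨c, hc, by rw [sum_congr_of_min_eq (hs ▸ hlt) hab, hs, minCover_congr_of_min_eq hlt hab], h0⟩

theorem isSlack_congr_of_min_eq {s : V} (hlt : minCover G U a < N)
    (hab : ∀ v ∈ U, min (a v) N = min (b v) N) : IsSlack G U a s ↔ IsSlack G U b s :=
  ⟨fun h => h.of_min_eq hlt hab, fun h =>
    h.of_min_eq ((minCover_congr_of_min_eq hlt hab).trans_lt hlt) fun v hv => (hab v hv).symm⟩

/-- Raising the weights without raising the minimum creates no new slack vertex. -/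
theorem IsSlack.of_le {s : V} (h : IsSlack G U b s) (hab : ∀ v ∈ U, a v ≤ b v)
    (he : minCover G U b = minCover G U a) : IsSlack G U a s := by
  obtain ⟨c, hc, hs, h0⟩ := h
  refine ⟨c, hc, le_antisymm ?_ (minCover_le hc U a), h0⟩
  rw [← he, ← hs]
  exact Finset.sum_le_sum fun v hv => Nat.mul_le_mul_left _ (hab v hv)

/-- The weight of a slack vertex can be raised without changing the minimum, and the vertex stays
slack. -/
theorem IsSlack.minCover_eq_and {s : V} (h : IsSlack G U a s) (hab : ∀ v ∈ U, a v ≤ b v)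
    (hne : ∀ v ∈ U, v ≠ s → b v = a v) :
    minCover G U b = minCover G U a ∧ IsSlack G U b s := by
  obtain ⟨c, hc, hs, h0⟩ := h
  have h1 : ∑ v ∈ U, c v * b v = ∑ v ∈ U, c v * a v := by
    refine Finset.sum_congr rfl fun v hv => ?_
    by_cases hvs : v = s
    · simp [hvs, h0]
    · rw [hne v hv hvs]
  have h2 : minCover G U b = minCover G U a :=
    le_antisymm (by rw [← hs, ← h1]; exact minCover_le hc U b) (minCover_mono hab)
  exact ⟨h2, c, hc, by rw [h1, hs, h2], h0⟩

/-- Adding a constant to a cover on one colour class of a bipartite component and subtracting it on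
the other gives a cover again. In the direction in which the weight does not grow, this can be done
until the cover vanishes somewhere in the component. -/
theorem exists_isSlack [Fintype V] (C : G.ConnectedComponent) (hC : C.toSimpleGraph.IsBipartite)
    (hU : ∀ v, v ∈ U ↔ G.connectedComponentMk v = C) (a : V → ℕ) :
    ∃ s ∈ U, IsSlack G U a s := by
  classical
  obtain ⟨col⟩ := hC
  -- the colouring of the component, extended by `0` to the other vertices
  let χ : V → Fin 2 := fun v => if hv : v ∈ C.supp then col ⟨v, hv⟩ else 0
  have hadjU : ∀ v w, G.Adj v w → (v ∈ U ↔ w ∈ U) := fun v w hvw => by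
    rw [hU, hU, SimpleGraph.ConnectedComponent.connectedComponentMk_eq_of_adj hvw]
  have hχ : ∀ v w, G.Adj v w → v ∈ U → χ v ≠ χ w := by
    intro v w hvw hv
    have hw := (hadjU v w hvw).1 hv
    have hv' : v ∈ C.supp := (hU v).1 hv
    have hw' : w ∈ C.supp := (hU w).1 hw
    simp only [χ, hv', hw', dif_pos]
    exact col.valid (v := ⟨v, hv'⟩) (w := ⟨w, hw'⟩) hvw
  obtain ⟨h, hh, hs⟩ := exists_sum_eq_minCover G U a
  -- the colour class `ε`, on which the cover decreases, is the heavier one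
  obtain ⟨ε, hε⟩ : ∃ ε : Fin 2,
      ∑ v ∈ U with χ v ≠ ε, a v ≤ ∑ v ∈ U with χ v = ε, a v := by
    have e : ∀ v, χ v ≠ 0 ↔ χ v = 1 := fun v => by omega
    have e' : ∀ v, χ v ≠ 1 ↔ χ v = 0 := fun v => by omega
    rcases le_total (∑ v ∈ U with χ v = 1, a v) (∑ v ∈ U with χ v = 0, a v) with h1 | h1
    · exact ⟨0, by simpa only [e] using h1⟩
    · exact ⟨1, by simpa only [e'] using h1⟩
  by_cases hne : (U.filter fun v => χ v = ε).Nonempty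
  · obtain ⟨s, hsm, hmin⟩ := Finset.exists_min_image _ h hne
    rw [Finset.mem_filter] at hsm
    have hmin' : ∀ v ∈ U, χ v = ε → h s ≤ h v := fun v hv hv' =>
      hmin v (Finset.mem_filter.2 ⟨hv, hv'⟩)
    let h' : V → ℕ := fun v => if v ∈ U then if χ v = ε then h v - h s else h v + h s else h v
    have hcov : IsTwoCover G h' := by
      intro v w hvw
      have h2 := hh v w hvw
      by_cases hv : v ∈ U
      · have hw := (hadjU v w hvw).1 hv
        have hc := hχ v w hvw hv
        simp only [h', hv, hw, if_true]
        by_cases h3 : χ v = ε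
        · have h4 : χ w ≠ ε := fun h => hc (h3.trans h.symm)
          have := hmin' v hv h3
          simp only [h3, h4, if_true, if_false]; omega
        · have h4 : χ w = ε := by omega
          have := hmin' w hw h4
          simp only [h3, h4, if_true, if_false]; omega
      · have hw : w ∉ U := fun h => hv ((hadjU v w hvw).2 h)
        simpa only [h', hv, hw, if_false] using h2
    refine ⟨s, hsm.1, h', hcov, le_antisymm ?_ (minCover_le hcov U a), by simp [h', hsm.1, hsm.2]⟩
    rw [← hs, ← Finset.sum_filter_add_sum_filter_not U (fun v => χ v = ε),
      ← Finset.sum_filter_add_sum_filter_not U (fun v => χ v = ε) fun v => h v * a v]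
    have e1 : ∑ v ∈ U with χ v = ε, h v * a v
        = ∑ v ∈ U with χ v = ε, h' v * a v + h s * ∑ v ∈ U with χ v = ε, a v := by
      rw [Finset.mul_sum, ← Finset.sum_add_distrib]
      refine Finset.sum_congr rfl fun v hv => ?_
      rw [Finset.mem_filter] at hv
      simp only [h', hv.1, hv.2, if_true]
      rw [← add_mul, Nat.sub_add_cancel (hmin' v hv.1 hv.2)]
    have e2 : ∑ v ∈ U with ¬ χ v = ε, h' v * a v
        = ∑ v ∈ U with ¬ χ v = ε, h v * a v + h s * ∑ v ∈ U with ¬ χ v = ε, a v := by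
      rw [Finset.mul_sum, ← Finset.sum_add_distrib]
      refine Finset.sum_congr rfl fun v hv => ?_
      rw [Finset.mem_filter] at hv
      simp only [h', hv.1, hv.2, if_true, if_false, add_mul]
    have : h s * ∑ v ∈ U with ¬ χ v = ε, a v ≤ h s * ∑ v ∈ U with χ v = ε, a v :=
      Nat.mul_le_mul_left (h s) hε
    rw [e1, e2]
    omega
  · -- one colour class is empty, so the component has no edge and the cover may vanish on it
    rw [Finset.not_nonempty_iff_eq_empty, Finset.filter_eq_empty_iff] at hne
    have hno : ∀ v w, G.Adj v w → v ∉ U := by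
      intro v w hvw hv
      have h1 := hχ v w hvw hv
      have h2 := hne hv
      have h3 := hne ((hadjU v w hvw).1 hv)
      omega
    obtain ⟨s, hsC⟩ := C.nonempty_supp
    have hsU : s ∈ U := (hU s).2 hsC
    let h' : V → ℕ := fun v => if v ∈ U then 0 else h v
    have hcov : IsTwoCover G h' := by
      intro v w hvw
      simp only [h', hno v w hvw, hno w v hvw.symm, if_false]
      exact hh v w hvw
    have h0 : ∑ v ∈ U, h' v * a v = 0 :=
      Finset.sum_eq_zero fun v hv => by simp [h', hv]
    refine ⟨s, hsU, h', hcov, ?_, by simp [h', hsU]⟩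
    have := minCover_le hcov U a
    omega

/-- Covers of the connected components can be glued. -/
theorem minCover_univ [Fintype V] [Fintype G.ConnectedComponent]
    [DecidableEq G.ConnectedComponent] (a : V → ℕ) :
    minCover G Finset.univ a
      = ∑ C, minCover G (Finset.univ.filter fun v => G.connectedComponentMk v = C) a := by
  apply le_antisymm
  · choose h hh hs using fun C : G.ConnectedComponent =>
      exists_sum_eq_minCover G (Finset.univ.filter fun v => G.connectedComponentMk v = C) a
    have hcov : IsTwoCover G fun v => h (G.connectedComponentMk v) v := by
      intro v w hvw
      have := hh (G.connectedComponentMk v) v w hvw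
      change 2 ≤ h (G.connectedComponentMk v) v + h (G.connectedComponentMk w) w
      rwa [← SimpleGraph.ConnectedComponent.connectedComponentMk_eq_of_adj hvw]
    refine (minCover_le hcov _ a).trans (le_of_eq ?_)
    rw [← Finset.sum_fiberwise Finset.univ (fun v => G.connectedComponentMk v)]
    refine Finset.sum_congr rfl fun C _ => ?_
    rw [← hs C]
    refine Finset.sum_congr rfl fun v hv => ?_
    rw [(Finset.mem_filter.1 hv).2]
  · obtain ⟨h, hh, hs⟩ := exists_sum_eq_minCover G Finset.univ a
    rw [← hs, ← Finset.sum_fiberwise Finset.univ (fun v => G.connectedComponentMk v)]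
    exact Finset.sum_le_sum fun C _ => minCover_le hh _ a

end Covers

/-! ### Partition of the exponent vectors into cells -/

section Cells

variable {V : Type*} {G : SimpleGraph V} {U : Finset V} {a b : V → ℕ} {N : ℕ}

/-- `s` is the first slack vertex of `U`, in the order given by an injective function `ρ`. -/
def IsFirstSlack (G : SimpleGraph V) (U : Finset V) (ρ : V → ℕ) (a : V → ℕ) (s : V) : Prop :=
  s ∈ U ∧ IsSlack G U a s ∧ ∀ u ∈ U, ρ u < ρ s → ¬ IsSlack G U a u

theorem exists_isFirstSlack (ρ : V → ℕ) (h : ∃ s ∈ U, IsSlack G U a s) :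
    ∃ s, IsFirstSlack G U ρ a s := by
  classical
  obtain ⟨s, hs⟩ := h
  obtain ⟨m, hm, hmin⟩ := Finset.exists_min_image (U.filter fun s => IsSlack G U a s) ρ
    ⟨s, Finset.mem_filter.2 hs⟩
  rw [Finset.mem_filter] at hm
  exact ⟨m, hm.1, hm.2, fun u hu hlt hsl =>
    (hmin u (Finset.mem_filter.2 ⟨hu, hsl⟩)).not_gt hlt⟩

theorem IsFirstSlack.eq {ρ : V → ℕ} (hρ : Function.Injective ρ) {s t : V}
    (hs : IsFirstSlack G U ρ a s) (ht : IsFirstSlack G U ρ a t) : s = t := by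
  apply hρ
  rcases lt_trichotomy (ρ s) (ρ t) with h | h | h
  · exact absurd hs.2.1 (ht.2.2 s hs.1 h)
  · exact h
  · exact absurd ht.2.1 (hs.2.2 t ht.1 h)

theorem isFirstSlack_congr_of_min_eq {ρ : V → ℕ} {s : V} (hlt : minCover G U a < N)
    (hab : ∀ v ∈ U, min (a v) N = min (b v) N) :
    IsFirstSlack G U ρ a s ↔ IsFirstSlack G U ρ b s := by
  simp only [IsFirstSlack, isSlack_congr_of_min_eq hlt hab]

/-- Raising the weight of the first slack vertex changes neither the minimum nor that vertex. -/
theorem IsFirstSlack.raise {ρ : V → ℕ} {s : V} (h : IsFirstSlack G U ρ a s)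
    (hab : ∀ v ∈ U, a v ≤ b v) (hne : ∀ v ∈ U, v ≠ s → b v = a v) :
    minCover G U b = minCover G U a ∧ IsFirstSlack G U ρ b s := by
  obtain ⟨h1, h2⟩ := h.2.1.minCover_eq_and hab hne
  exact ⟨h1, h.1, h2, fun u hu hlt hsl => h.2.2 u hu hlt (hsl.of_le hab h1)⟩

/-- `β` and `Z` cut the vectors `a` on `U` with `minCover G U a < N` into finitely many cells
`β a + ℕ^(Z a)`, on each of which `minCover G U` is constant. -/
structure IsCellMap (G : SimpleGraph V) (U : Finset V) (N : ℕ) (β : (V → ℕ) → V → ℕ)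
    (Z : (V → ℕ) → Set V) : Prop where
  le : ∀ a, minCover G U a < N → ∀ v ∈ U, β a v ≤ a v
  le_bound : ∀ a, minCover G U a < N → ∀ v ∈ U, β a v ≤ N
  eq : ∀ a, minCover G U a < N → ∀ v ∈ U, v ∉ Z a → a v = β a v
  const : ∀ a, minCover G U a < N → ∀ b : V → ℕ, (∀ v ∈ U, β a v ≤ b v) →
    (∀ v ∈ U, v ∉ Z a → b v = β a v) →
      minCover G U b = minCover G U a ∧ ∀ v ∈ U, β b v = β a v ∧ (v ∈ Z b ↔ v ∈ Z a)

theorem isCellMap_trunc (G : SimpleGraph V) (U : Finset V) (N : ℕ) :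
    IsCellMap G U N (fun a v => min (a v) N) (fun a => {v | N ≤ a v}) where
  le a _ v _ := min_le_left _ _
  le_bound a _ v _ := min_le_right _ _
  eq a _ v _ hv := by
    have : ¬ N ≤ a v := hv
    omega
  const a ha b h1 h2 := by
    have key : ∀ v ∈ U, min (a v) N = min (b v) N := by
      intro v hv
      have h3 := h1 v hv
      by_cases h4 : N ≤ a v
      · omega
      · have := h2 v hv h4
        omega
    refine ⟨minCover_congr_of_min_eq ha key, fun v hv => ⟨(key v hv).symm, ?_⟩⟩
    have := key v hv
    change N ≤ b v ↔ N ≤ a v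
    omega

/-- If there is always a slack vertex in `U`, then each cell can be given a free direction: the one
of the first slack vertex `s`. Its cell starts at the least value of the coordinate `s` for which
`s` is the first slack vertex. -/
theorem exists_isCellMap_of_isSlack [Finite V] (G : SimpleGraph V) (U : Finset V) (N : ℕ)
    (hU : ∀ a, ∃ s ∈ U, IsSlack G U a s) :
    ∃ β Z, IsCellMap G U N β Z ∧ ∀ a, ∃ s ∈ U, s ∈ Z a := by
  classical
  obtain ⟨n, ⟨e⟩⟩ := Finite.exists_equiv_fin V
  let ρ : V → ℕ := fun v => e v
  have hρ : Function.Injective ρ := Fin.val_injective.comp e.injective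
  choose σ hσ using fun a => exists_isFirstSlack ρ (hU a)
  have hex : ∀ a, ∃ t, IsFirstSlack G U ρ (Function.update a (σ a) t) (σ a) := fun a =>
    ⟨a (σ a), by rw [Function.update_eq_self]; exact hσ a⟩
  let r : (V → ℕ) → ℕ := fun a => Nat.find (hex a)
  have hr : ∀ a, IsFirstSlack G U ρ (Function.update a (σ a) (r a)) (σ a) := fun a =>
    Nat.find_spec (hex a)
  have hrle : ∀ a, r a ≤ a (σ a) := fun a =>
    Nat.find_min' (hex a) (by rw [Function.update_eq_self]; exact hσ a)
  have hup : ∀ a t, r a ≤ t →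
      minCover G U (Function.update a (σ a) t)
        = minCover G U (Function.update a (σ a) (r a)) := by
    intro a t ht
    refine ((hr a).raise (fun v _ => ?_) fun v _ hv => ?_).1
    · by_cases hv : v = σ a
      · subst hv; simpa using ht
      · simp [hv]
    · simp [hv]
  have hmc : ∀ a, minCover G U (Function.update a (σ a) (r a)) = minCover G U a := fun a => by
    rw [← hup a _ (hrle a), Function.update_eq_self]
  have hlow : ∀ a t, t ≤ a (σ a) → minCover G U (Function.update a (σ a) t) ≤ minCover G U a := by
    intro a t ht
    refine minCover_mono fun v _ => ?_
    by_cases hv : v = σ a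
    · subst hv; simpa using ht
    · simp [hv]
  have hrN : ∀ a, minCover G U a < N → r a ≤ N := by
    intro a ha
    by_contra! hlt
    have h1 := hrle a
    refine Nat.find_min (hex a) hlt ?_
    rw [isFirstSlack_congr_of_min_eq (b := a) ((hlow a N (by omega)).trans_lt ha)]
    · exact hσ a
    · intro v _
      by_cases hv : v = σ a
      · subst hv; simp; omega
      · simp [hv]
  refine ⟨fun a => Function.update (fun v => min (a v) N) (σ a) (r a),
    fun a => {v | v = σ a ∨ N ≤ a v}, ⟨?_, ?_, ?_, ?_⟩, fun a => ⟨σ a, (hσ a).1, Or.inl rfl⟩⟩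
  · intro a ha v _
    by_cases hv : v = σ a
    · subst hv; simpa using hrle a
    · simp [hv]
  · intro a ha v _
    by_cases hv : v = σ a
    · subst hv; simpa using hrN a ha
    · simp [hv]
  · intro a ha v _ hv
    have hv1 : v ≠ σ a := fun h => hv (Or.inl h)
    have hv2 : ¬ N ≤ a v := fun h => hv (Or.inr h)
    simp only [Function.update_of_ne hv1]
    omega
  · intro a ha b h1 h2
    have key : ∀ v ∈ U, v ≠ σ a → min (a v) N = min (b v) N := by
      intro v hv hvs
      have h3 := h1 v hv
      simp only [Function.update_of_ne hvs] at h3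
      by_cases h4 : N ≤ a v
      · omega
      · have := h2 v hv (by rintro (h | h) <;> contradiction)
        simp only [Function.update_of_ne hvs] at this
        omega
    have key' : ∀ t, ∀ v ∈ U, min (Function.update a (σ a) t v) N
        = min (Function.update b (σ a) t v) N := by
      intro t v hv
      by_cases hvs : v = σ a
      · simp [hvs]
      · simpa [hvs] using key v hv hvs
    have hrb : r a ≤ b (σ a) := by simpa using h1 (σ a) (hσ a).1
    have ha' : minCover G U (Function.update a (σ a) (r a)) < N := (hmc a).trans_lt ha
    have h3 : IsFirstSlack G U ρ (Function.update b (σ a) (r a)) (σ a) :=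
      (isFirstSlack_congr_of_min_eq ha' (key' _)).1 (hr a)
    obtain ⟨h4, h5⟩ := h3.raise (b := b)
      (fun v _ => by
        by_cases hv : v = σ a
        · subst hv; simpa using hrb
        · simp [hv])
      (fun v _ hv => by simp [hv])
    have hσb : σ b = σ a := (hσ b).eq hρ h5
    have h6 : minCover G U b = minCover G U a := by
      rw [h4, minCover_congr_of_min_eq ha' (key' _), hmc]
    have hrr : r b = r a := by
      have hb' : minCover G U b < N := h6.trans_lt ha
      apply le_antisymm
      · refine Nat.find_min' (hex b) ?_
        rw [hσb]; exact h3
      · refine Nat.find_min' (hex a) ?_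
        have h7 := hr b
        have h8 := (hmc b).trans_lt hb'
        rw [hσb] at h7 h8
        exact (isFirstSlack_congr_of_min_eq h8 fun v hv => (key' _ v hv).symm).1 h7
    refine ⟨h6, fun v hv => ?_⟩
    by_cases hvs : v = σ a
    · simp [hvs, hσb, hrr]
    · have h9 := key v hv hvs
      refine ⟨by simp only [hσb, Function.update_of_ne hvs]; exact h9.symm, ?_⟩
      change (v = σ b ∨ N ≤ b v) ↔ (v = σ a ∨ N ≤ a v)
      rw [hσb]
      simp only [hvs, false_or]
      omega

/-- The vectors `a` on which `minCover` is `2 * k` or `2 * k + 1` are partitioned into finitely many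
cells `c + ℕ^Z`. Here `Z` has at least one element in each bipartite component, whence the bound on
its cardinality. -/
theorem exists_cell_partition [Fintype V] (G : SimpleGraph V) (k : ℕ) :
    ∃ (l : ℕ) (c : Fin l → V → ℕ) (Z : Fin l → Finset V),
      (∀ j, numBipartiteComponents G ≤ (Z j).card) ∧
      (∀ j b, (∀ v, c j v ≤ b v) → (∀ v, v ∉ Z j → b v = c j v) →
        2 * k ≤ minCover G Finset.univ b ∧ minCover G Finset.univ b < 2 * (k + 1)) ∧
      ∀ a, 2 * k ≤ minCover G Finset.univ a → minCover G Finset.univ a < 2 * (k + 1) →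
        ∃! j, (∀ v, c j v ≤ a v) ∧ ∀ v, v ∉ Z j → a v = c j v := by
  classical
  have : Fintype G.ConnectedComponent := Fintype.ofFinite _
  let N := 2 * (k + 1)
  let U : G.ConnectedComponent → Finset V := fun C =>
    Finset.univ.filter fun v => G.connectedComponentMk v = C
  have hmemU : ∀ C v, v ∈ U C ↔ G.connectedComponentMk v = C := fun C v => by simp [U]
  have hself : ∀ v, v ∈ U (G.connectedComponentMk v) := fun v => (hmemU _ v).2 rfl
  have hcell : ∀ C : G.ConnectedComponent, ∃ β Z, IsCellMap G (U C) N β Z ∧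
      (C.toSimpleGraph.IsBipartite → ∀ a, ∃ s ∈ U C, s ∈ Z a) := by
    intro C
    by_cases hC : C.toSimpleGraph.IsBipartite
    · obtain ⟨β, Z, h1, h2⟩ := exists_isCellMap_of_isSlack G (U C) N
        (exists_isSlack C hC (hmemU C))
      exact ⟨β, Z, h1, fun _ => h2⟩
    · exact ⟨_, _, isCellMap_trunc G (U C) N, fun h => absurd h hC⟩
  choose β Z hcm hslack using hcell
  let B : (V → ℕ) → V → ℕ := fun a v => β (G.connectedComponentMk v) a v
  let W : (V → ℕ) → Finset V := fun a =>
    Finset.univ.filter fun v => v ∈ Z (G.connectedComponentMk v) a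
  have hmemW : ∀ a v, v ∈ W a ↔ v ∈ Z (G.connectedComponentMk v) a := fun a v => by simp [W]
  let A : Set (V → ℕ) :=
    {a | 2 * k ≤ minCover G Finset.univ a ∧ minCover G Finset.univ a < 2 * (k + 1)}
  have hA : ∀ a ∈ A, ∀ C, minCover G (U C) a < N := by
    intro a ha C
    refine lt_of_le_of_lt ?_ ha.2
    rw [minCover_univ]
    exact Finset.single_le_sum (f := fun C => minCover G (U C) a) (fun _ _ => Nat.zero_le _)
      (Finset.mem_univ C)
  have hle : ∀ a ∈ A, ∀ v, B a v ≤ a v := fun a ha v =>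
    (hcm _).le a (hA a ha _) v (hself v)
  have heq : ∀ a ∈ A, ∀ v, v ∉ W a → a v = B a v := fun a ha v hv =>
    (hcm _).eq a (hA a ha _) v (hself v) fun h => hv ((hmemW a v).2 h)
  have hconst : ∀ a ∈ A, ∀ b : V → ℕ, (∀ v, B a v ≤ b v) → (∀ v, v ∉ W a → b v = B a v) →
      b ∈ A ∧ B b = B a ∧ W b = W a := by
    intro a ha b h1 h2
    have h3 := fun C => (hcm C).const a (hA a ha C) b
      (fun v hv => by
        obtain rfl := (hmemU C v).1 hv
        exact h1 v)
      (fun v hv hvZ => by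
        obtain rfl := (hmemU C v).1 hv
        exact h2 v fun h => hvZ ((hmemW a v).1 h))
    have h4 : minCover G Finset.univ b = minCover G Finset.univ a := by
      rw [minCover_univ, minCover_univ]
      exact Finset.sum_congr rfl fun C _ => (h3 C).1
    refine ⟨⟨h4 ▸ ha.1, h4 ▸ ha.2⟩, ?_, ?_⟩
    · funext v
      exact ((h3 _).2 v (hself v)).1
    · ext v
      rw [hmemW, hmemW]
      exact ((h3 _).2 v (hself v)).2
  have hfin : ((fun a => (B a, W a)) '' A).Finite := by
    refine Set.Finite.subset ((Set.finite_Iic (fun _ : V => N)).prod Set.finite_univ) ?_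
    rintro _ ⟨a, ha, rfl⟩
    exact ⟨fun v => (hcm _).le_bound a (hA a ha _) v (hself v), trivial⟩
  have : Finite ((fun a => (B a, W a)) '' A) := hfin
  obtain ⟨l, ⟨e⟩⟩ := Finite.exists_equiv_fin ((fun a => (B a, W a)) '' A)
  choose rep hrepA hrep using fun j => (e.symm j).2
  refine ⟨l, fun j => B (rep j), fun j => W (rep j), ?_, ?_, ?_⟩
  · intro j
    choose s hsU hsZ using fun C : {C : G.ConnectedComponent // C.toSimpleGraph.IsBipartite} =>
      hslack C.1 C.2 (rep j)
    have hs : ∀ C, G.connectedComponentMk (s C) = C.1 := fun C => (hmemU _ _).1 (hsU C)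
    have hinj : Function.Injective fun C =>
        (⟨s C, (hmemW (rep j) _).2 (by rw [hs]; exact hsZ C)⟩ : W (rep j)) := by
      intro C D hCD
      have h1 : s C = s D := congrArg Subtype.val hCD
      exact Subtype.ext (by rw [← hs C, ← hs D, h1])
    simpa [numBipartiteComponents] using Nat.card_le_card_of_injective _ hinj
  · exact fun j b h1 h2 => (hconst _ (hrepA j) b h1 h2).1
  · intro a ha1 ha2
    have ha : a ∈ A := ⟨ha1, ha2⟩
    have hrep' : ∀ j, (B (rep j), W (rep j)) = (e.symm j).1 := hrep
    refine ⟨e ⟨(B a, W a), a, ha, rfl⟩, ?_, ?_⟩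
    · have h1 := hrep' (e ⟨(B a, W a), a, ha, rfl⟩)
      rw [Equiv.symm_apply_apply, Prod.mk.injEq] at h1
      simp only [h1.1, h1.2]
      exact ⟨hle a ha, heq a ha⟩
    · rintro j ⟨h1, h2⟩
      obtain ⟨-, h3, h4⟩ := hconst _ (hrepA j) a h1 h2
      rw [← e.symm_apply_eq]
      exact Subtype.ext ((hrep' j).symm.trans (Prod.ext h3.symm h4.symm))

end Cells

/-! ### Integral closures of powers of the edge ideal -/

section EdgeIdealClosure

/-- The ideals `(X ^ n)` are integrally closed: an element `F` with an integral equation over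
`(X ^ n)` is divisible by `X ^ n`. The exponent is raised one by one: if `X ^ j` divides `F` and
`j < n`, then all terms of the equation but the first are divisible by `X ^ (j * d + 1)`. -/
theorem Polynomial.X_pow_dvd_of_integral_equation {R : Type*} [CommRing R] [IsDomain R] {n d : ℕ}
    {F : Polynomial R} {c : ℕ → Polynomial R}
    (hc : ∀ i ∈ Finset.Icc 1 d, Polynomial.X ^ (n * i) ∣ c i)
    (h : F ^ d + ∑ i ∈ Finset.Icc 1 d, c i * F ^ (d - i) = 0) :
    Polynomial.X ^ n ∣ F := by
  suffices H : ∀ j ≤ n, Polynomial.X ^ j ∣ F from H n le_rfl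
  intro j
  induction j with
  | zero => simp
  | succ j ih =>
    intro hj
    obtain ⟨E, rfl⟩ := ih (by omega)
    have h1 : Polynomial.X ^ (j * d + 1) ∣ (Polynomial.X ^ j * E) ^ d := by
      rw [eq_neg_of_add_eq_zero_left h, dvd_neg]
      refine Finset.dvd_sum fun i hi => ?_
      have hi' := Finset.mem_Icc.1 hi
      have h2 : j * d + 1 ≤ n * i + j * (d - i) := by
        obtain ⟨e, rfl⟩ := Nat.exists_eq_add_of_le hi'.2
        have h3 : (j + 1) * i ≤ n * i := Nat.mul_le_mul_right i hj
        rw [Nat.add_sub_cancel_left, mul_add]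
        have : (j + 1) * i = j * i + i := by ring
        omega
      refine (pow_dvd_pow _ h2).trans ?_
      rw [pow_add]
      refine mul_dvd_mul (hc i hi) ?_
      rw [mul_pow, ← pow_mul]
      exact dvd_mul_right _ _
    rw [mul_pow, ← pow_mul, pow_add, pow_one] at h1
    have h4 := Polynomial.prime_X.dvd_of_dvd_pow
      ((mul_dvd_mul_iff_left (pow_ne_zero _ Polynomial.X_ne_zero)).1 h1)
    rw [pow_succ]
    exact mul_dvd_mul_left _ h4

variable {K : Type*} [Field K] {V : Type*} {G : SimpleGraph V}

/-- The substitution `x_v ↦ x_v T ^ h v`, which records in the exponent of `T` the weight of each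
monomial with respect to `h`. -/
noncomputable def weightHom (K : Type*) [Field K] {V : Type*} (h : V → ℕ) :
    MvPolynomial V K →ₐ[K] Polynomial (MvPolynomial V K) :=
  MvPolynomial.aeval fun v => Polynomial.C (MvPolynomial.X v) * Polynomial.X ^ h v

theorem weightHom_monomial [Fintype V] (h : V → ℕ) (m : V →₀ ℕ) (r : K) :
    weightHom K h (MvPolynomial.monomial m r)
      = Polynomial.monomial (∑ v, h v * m v) (MvPolynomial.monomial m r) := by
  rw [weightHom, MvPolynomial.aeval_monomial, Finsupp.prod_fintype _ _ (by simp)]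
  simp only [mul_pow, Finset.prod_mul_distrib, ← pow_mul, Finset.prod_pow_eq_pow_sum]
  rw [← Polynomial.C_mul_X_pow_eq_monomial, ← mul_assoc]
  congr 1
  rw [MvPolynomial.monomial_eq, Finsupp.prod_fintype _ _ (by simp), map_mul, map_prod]
  simp only [map_pow]
  rfl

theorem coeff_coeff_weightHom [Fintype V] (h : V → ℕ) (f : MvPolynomial V K) (m : V →₀ ℕ) :
    ((weightHom K h f).coeff (∑ v, h v * m v)).coeff m = f.coeff m := by
  classical
  conv_lhs => rw [f.as_sum, map_sum, Polynomial.finsetSum_coeff, MvPolynomial.coeff_sum]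
  conv_rhs => rw [f.as_sum, MvPolynomial.coeff_sum]
  refine Finset.sum_congr rfl fun a _ => ?_
  rw [weightHom_monomial, Polynomial.coeff_monomial]
  by_cases hm : a = m
  · simp [hm]
  · split_ifs <;> simp [MvPolynomial.coeff_monomial, hm]

theorem X_pow_dvd_weightHom {h : V → ℕ} (hh : IsTwoCover G h) {n : ℕ} {f : MvPolynomial V K}
    (hf : f ∈ edgeIdeal K G ^ n) : Polynomial.X ^ (2 * n) ∣ weightHom K h f := by
  rw [← Ideal.mem_span_singleton, pow_mul, ← Ideal.span_singleton_pow]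
  have h1 : (edgeIdeal K G).map (weightHom K h) ≤ Ideal.span {Polynomial.X ^ 2} := by
    rw [edgeIdeal, Ideal.map_span, Ideal.span_le]
    rintro _ ⟨_, ⟨v, w, hvw, rfl⟩, rfl⟩
    rw [SetLike.mem_coe, Ideal.mem_span_singleton]
    simp only [weightHom, map_mul, MvPolynomial.aeval_X]
    refine (pow_dvd_pow _ (hh v w hvw)).trans ?_
    rw [pow_add]
    exact mul_dvd_mul (dvd_mul_left _ _) (dvd_mul_left _ _)
  exact Ideal.pow_right_mono h1 n (Ideal.map_pow (weightHom K h) _ n ▸ Ideal.mem_map_of_mem _ hf)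

theorem le_sum_of_mem_idealIntegralClosure [Fintype V] {k : ℕ} {f : MvPolynomial V K}
    (hf : f ∈ idealIntegralClosure (edgeIdeal K G ^ k)) {m : V →₀ ℕ} (hm : m ∈ f.support)
    {h : V → ℕ} (hh : IsTwoCover G h) : 2 * k ≤ ∑ v, h v * m v := by
  obtain ⟨d, -, c, hc, he⟩ := hf
  have h1 : Polynomial.X ^ (2 * k) ∣ weightHom K h f := by
    refine Polynomial.X_pow_dvd_of_integral_equation (d := d) (c := fun i => weightHom K h (c i))
      (fun i hi => ?_) ?_
    · rw [mul_assoc]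
      exact X_pow_dvd_weightHom hh (pow_mul (edgeIdeal K G) k i ▸ hc i hi)
    · simpa using congrArg (weightHom K h) he
  by_contra! hlt
  have h2 := coeff_coeff_weightHom h f m
  rw [Polynomial.X_pow_dvd_iff.1 h1 _ hlt, MvPolynomial.coeff_zero] at h2
  exact MvPolynomial.mem_support_iff.1 hm h2.symm

/-- König's theorem for the bipartite double cover of `G` with vertex capacities `a`, in the form of
a product of `2 * k` edges dividing `x ^ (2 a)`. It is derived from Hall's marriage theorem: the
left side has `a v` copies of each vertex `v`, and so has the right side, which gets `|a| - 2 * k`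
further elements that are joined to everything. -/
theorem prod_pow_sq_mem_edgeIdeal_pow [Fintype V] {k : ℕ} {a : V → ℕ}
    (ha : ∀ h, IsTwoCover G h → 2 * k ≤ ∑ v, h v * a v) :
    (∏ v, (MvPolynomial.X v : MvPolynomial V K) ^ a v) ^ 2 ∈ edgeIdeal K G ^ (2 * k) := by
  classical
  let L := Σ v : V, Fin (a v)
  have hL : Fintype.card L = ∑ v, a v := by simp [L]
  have hkL : 2 * k ≤ Fintype.card L := by
    rw [hL]
    simpa using ha (fun _ => 1) fun _ _ _ => le_rfl
  let d := Fintype.card L - 2 * k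
  have hfib : ∀ T : Finset V, (Finset.univ.filter fun x : L => x.1 ∈ T).card = ∑ v ∈ T, a v := by
    intro T
    have : (Finset.univ.filter fun x : L => x.1 ∈ T) = T.sigma fun v => Finset.univ := by
      ext x
      rw [Finset.mem_filter, Finset.mem_sigma]
      simp
    rw [this, Finset.card_sigma]
    simp
  let t : L → Finset (L ⊕ Fin d) := fun x =>
    Finset.univ.disjSum Finset.univ |>.filter fun y => ∀ z, y = Sum.inl z → G.Adj x.1 z.1
  have hHall : ∀ S : Finset L, S.card ≤ (S.biUnion t).card := by
    intro S
    rcases S.eq_empty_or_nonempty with rfl | ⟨x₀, hx₀⟩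
    · simp
    let T := S.image Sigma.fst
    let T' := Finset.univ.filter fun w => ∃ v ∈ T, G.Adj v w
    have h1 : S.card ≤ ∑ v ∈ T, a v := by
      rw [← hfib]
      exact Finset.card_le_card fun x hx =>
        Finset.mem_filter.2 ⟨Finset.mem_univ _, Finset.mem_image_of_mem _ hx⟩
    have h2 : (∑ v ∈ T', a v) + d ≤ (S.biUnion t).card := by
      have : (Finset.univ.filter fun x : L => x.1 ∈ T').disjSum (Finset.univ : Finset (Fin d))
          ⊆ S.biUnion t := by
        intro y hy
        rw [Finset.mem_biUnion]
        rcases y with z | z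
        · simp only [Finset.inl_mem_disjSum, Finset.mem_filter, Finset.mem_univ, true_and, T',
            T, Finset.mem_image] at hy
          obtain ⟨_, ⟨x, hx, rfl⟩, hxz⟩ := hy
          exact ⟨x, hx, by simp [t, hxz]⟩
        · exact ⟨x₀, hx₀, by simp [t]⟩
      have := Finset.card_le_card this
      rwa [Finset.card_disjSum, hfib, Finset.card_univ, Fintype.card_fin] at this
    -- the complement of `T` on the left and the neighbours of `T` on the right form a vertex cover
    -- of the double cover; summing over the two copies of a vertex gives a cover of `G`
    have h3 := ha (fun v => (if v ∈ T then 0 else 1) + if v ∈ T' then 1 else 0) (by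
      intro v w hvw
      have e1 : v ∈ T → w ∈ T' := fun hv => by simp only [T', Finset.mem_filter]; exact
        ⟨Finset.mem_univ _, v, hv, hvw⟩
      have e2 : w ∈ T → v ∈ T' := fun hv => by simp only [T', Finset.mem_filter]; exact
        ⟨Finset.mem_univ _, w, hv, hvw.symm⟩
      by_cases hv : v ∈ T <;> by_cases hw : w ∈ T <;> simp [hv, hw, e1, e2]; omega)
    have h4 : ∑ v, ((if v ∈ T then 0 else 1) + if v ∈ T' then 1 else 0) * a v
        + ∑ v ∈ T, a v = ∑ v, a v + ∑ v ∈ T', a v := by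
      have e : ∀ T : Finset V, ∑ v ∈ T, a v = ∑ v, if v ∈ T then a v else 0 := by simp
      rw [e T, e T', ← Finset.sum_add_distrib, ← Finset.sum_add_distrib]
      refine Finset.sum_congr rfl fun v _ => ?_
      split_ifs <;> ring
    omega
  obtain ⟨f, hf, hft⟩ := (Finset.all_card_le_biUnion_card_iff_exists_injective t).1 hHall
  let g : L → L := fun x => Sum.elim id (fun _ => x) (f x)
  let M := Finset.univ.filter fun x : L => (f x).isLeft
  have hg : ∀ x ∈ M, f x = Sum.inl (g x) := by
    intro x hx
    have h1 : (f x).isLeft := (Finset.mem_filter.1 hx).2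
    rcases hfx : f x with z | z
    · simp [g, hfx]
    · simp [hfx] at h1
  have hM : 2 * k ≤ M.card := by
    have h1 : (Finset.univ.filter fun x : L => ¬ (f x).isLeft).card ≤ d := by
      have h2 := Finset.card_le_card_of_injOn (s := Finset.univ.filter fun x : L => ¬ (f x).isLeft)
        (t := (Finset.univ : Finset (Fin d)).map Function.Embedding.inr) f
        (fun x hx => by
          have h3 : ¬ (f x).isLeft := (Finset.mem_filter.1 hx).2
          rcases hfx : f x with z | z
          · simp [hfx] at h3
          · simp) hf.injOn
      simpa using h2
    have h2 := Finset.card_filter_add_card_filter_not (s := (Finset.univ : Finset L))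
      fun x => (f x).isLeft
    rw [Finset.card_univ] at h2
    change M.card + _ = _ at h2
    omega
  obtain ⟨M', hM', hcard⟩ := Finset.exists_subset_card_eq hM
  have hmem : ∏ x ∈ M', ((MvPolynomial.X x.1 : MvPolynomial V K) * MvPolynomial.X (g x).1)
      ∈ edgeIdeal K G ^ (2 * k) := by
    rw [← hcard, ← Finset.prod_const]
    refine Ideal.prod_mem_prod fun x hx => Ideal.subset_span ⟨x.1, (g x).1, ?_, rfl⟩
    exact (Finset.mem_filter.1 (hft x)).2 _ (hg x (hM' hx))
  have hQ : ∏ v, (MvPolynomial.X v : MvPolynomial V K) ^ a v = ∏ x : L, MvPolynomial.X x.1 := by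
    simp [L, Fintype.prod_sigma]
  refine Ideal.mem_of_dvd _ ?_ hmem
  rw [Finset.prod_mul_distrib, pow_two, hQ]
  refine mul_dvd_mul (Finset.prod_dvd_prod_of_subset _ _ _ (Finset.subset_univ _)) ?_
  rw [← Finset.prod_image (g := g) (f := fun x : L => (MvPolynomial.X x.1 : MvPolynomial V K))]
  · exact Finset.prod_dvd_prod_of_subset _ _ _ (Finset.subset_univ _)
  · intro x hx y hy hxy
    exact hf (by rw [hg x (hM' hx), hg y (hM' hy)]; exact congrArg _ hxy)

/-- The Newton polyhedron of the edge ideal in terms of its half-integral vertex covers. -/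
theorem mem_idealIntegralClosure_iff [Fintype V] {k : ℕ} {f : MvPolynomial V K} :
    f ∈ idealIntegralClosure (edgeIdeal K G ^ k) ↔
      ∀ m ∈ f.support, 2 * k ≤ minCover G Finset.univ m := by
  simp only [le_minCover_iff]
  refine ⟨fun hf m hm h hh => le_sum_of_mem_idealIntegralClosure hf hm hh, fun hf => ?_⟩
  rw [f.as_sum]
  refine Ideal.sum_mem _ fun m hm => ?_
  rw [MvPolynomial.monomial_eq, Finsupp.prod_fintype _ _ (by simp)]
  refine Ideal.mul_mem_left _ _ ?_
  have h1 := prod_pow_sq_mem_edgeIdeal_pow (K := K) (hf m hm)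
  refine ⟨2, two_pos, fun i => if i = 2 then -(∏ v, MvPolynomial.X v ^ m v) ^ 2 else 0, ?_, ?_⟩
  · intro i _
    dsimp only
    split_ifs with hi
    · rw [hi, ← pow_mul, mul_comm]
      exact Ideal.neg_mem_iff _ |>.2 h1
    · exact Ideal.zero_mem _
  · simp

end EdgeIdealClosure

/-! ### Stanley decompositions from partitions of the exponent vectors -/

section Decomposition

variable {K : Type*} [Field K] {σ : Type*} {I J : Ideal (MvPolynomial σ K)} {A B : Set (σ →₀ ℕ)}

/-- The exponent vectors of the Stanley space `x ^ c 𝕂[Z]`. -/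
def exponentCell {σ : Type*} (c : σ →₀ ℕ) (Z : Finset σ) : Set (σ →₀ ℕ) :=
  {m | (∀ v, c v ≤ m v) ∧ ∀ v, v ∉ Z → m v = c v}

theorem monomial_mem_supported {Z : Finset σ} {m : σ →₀ ℕ} (r : K) (h : ∀ v, v ∉ Z → m v = 0) :
    MvPolynomial.monomial m r ∈ MvPolynomial.supported K (Z : Set σ) := by
  classical
  rw [MvPolynomial.mem_supported]
  intro v hv
  by_contra hvZ
  rw [Finset.mem_coe, MvPolynomial.mem_vars_iff_mem_support] at hv
  obtain ⟨n, hn, hvn⟩ := hv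
  have := MvPolynomial.support_monomial_subset hn
  rw [Finset.mem_singleton] at this
  subst this
  exact Finsupp.mem_support_iff.1 hvn (h v hvZ)

theorem eq_zero_of_mem_support_of_mem_supported {Z : Finset σ} {p : MvPolynomial σ K}
    (hp : p ∈ MvPolynomial.supported K (Z : Set σ)) {m : σ →₀ ℕ} (hm : m ∈ p.support) {v : σ}
    (hv : v ∉ Z) : m v = 0 := by
  by_contra h
  exact hv (MvPolynomial.mem_supported.1 hp
    ((MvPolynomial.mem_vars_iff_mem_support v).2 ⟨m, hm, Finsupp.mem_support_iff.2 h⟩))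

theorem add_mem_exponentCell {c m : σ →₀ ℕ} {Z : Finset σ} (h : ∀ v, v ∉ Z → m v = 0) :
    m + c ∈ exponentCell c Z :=
  ⟨fun v => by simp, fun v hv => by simp [h v hv]⟩

/-- The class in `I / J` of the monomial `x ^ m`, where `m` is an exponent vector of `I`. -/
noncomputable def monomialClass (J : Ideal (MvPolynomial σ K))
    (hI : ∀ f, f ∈ I ↔ ∀ m ∈ f.support, m ∈ A) (m : A) : I ⧸ J.submoduleOf I :=
  (J.submoduleOf I).mkQ ⟨MvPolynomial.monomial m.1 1, (hI _).2 fun n hn => by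
    classical
    rw [Finset.mem_singleton.1 (MvPolynomial.support_monomial_subset hn)]; exact m.2⟩

/-- The coefficient of `x ^ m` as a functional on `I / J`, where `m` is not an exponent vector of
`J`. -/
noncomputable def quotientCoeff (I : Ideal (MvPolynomial σ K))
    (hJ : ∀ f, f ∈ J ↔ ∀ m ∈ f.support, m ∈ B) (m : σ →₀ ℕ) (hm : m ∉ B) :
    (I ⧸ J.submoduleOf I) →ₗ[K] K :=
  ((J.submoduleOf I).restrictScalars K).liftQ
    ((MvPolynomial.lcoeff K m).comp ((Submodule.subtype I).restrictScalars K)) fun f hf => by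
      by_contra h
      exact hm ((hJ _).1 hf m (MvPolynomial.mem_support_iff.2 h))

theorem quotientCoeff_mkQ (hJ : ∀ f, f ∈ J ↔ ∀ m ∈ f.support, m ∈ B) (m : σ →₀ ℕ) (hm : m ∉ B)
    (f : I) : quotientCoeff I hJ m hm ((J.submoduleOf I).mkQ f) = (f : MvPolynomial σ K).coeff m :=
  rfl

theorem linearIndependent_monomialClass (hI : ∀ f, f ∈ I ↔ ∀ m ∈ f.support, m ∈ A)
    (hJ : ∀ f, f ∈ J ↔ ∀ m ∈ f.support, m ∈ B) :
    LinearIndependent K fun m : {m : A // m.1 ∉ B} => monomialClass J hI m.1 := by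
  classical
  refine LinearIndependent.of_pairwise_dual_eq_zero_one _
    (fun m => quotientCoeff I hJ m.1.1 m.2) (fun m n hmn => ?_) fun m => ?_
  · simp only [monomialClass]
    rw [quotientCoeff_mkQ, MvPolynomial.coeff_monomial, if_neg]
    exact fun h => hmn (Subtype.ext (Subtype.ext h.symm))
  · simp only [monomialClass]
    rw [quotientCoeff_mkQ, MvPolynomial.coeff_monomial, if_pos rfl]

/-- The class of `f` in `I / J` is a combination of the classes of its monomials outside `J`. -/
theorem mkQ_mem_of_monomialClass_mem (hI : ∀ f, f ∈ I ↔ ∀ m ∈ f.support, m ∈ A)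
    (hJ : ∀ f, f ∈ J ↔ ∀ m ∈ f.support, m ∈ B) {T : Submodule K (I ⧸ J.submoduleOf I)} (f : I)
    (hT : ∀ m : A, m.1 ∈ (f : MvPolynomial σ K).support → m.1 ∉ B → monomialClass J hI m ∈ T) :
    (J.submoduleOf I).mkQ f ∈ T := by
  classical
  have hA : ∀ m ∈ (f : MvPolynomial σ K).support, m ∈ A := (hI _).1 f.2
  have hsum : (J.submoduleOf I).mkQ f = ∑ m ∈ (f : MvPolynomial σ K).support.attach,
      (f : MvPolynomial σ K).coeff m.1 • monomialClass J hI ⟨m.1, hA m.1 m.2⟩ := by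
    have h1 : ∀ (r : K) (x : I), (J.submoduleOf I).mkQ (r • x) = r • (J.submoduleOf I).mkQ x :=
      fun _ _ => rfl
    simp only [monomialClass, ← h1, ← map_sum]
    congr 1
    apply Subtype.ext
    rw [AddSubmonoidClass.coe_finsetSum]
    conv_lhs => rw [(f : MvPolynomial σ K).as_sum, ← Finset.sum_attach]
    refine Finset.sum_congr rfl fun m _ => ?_
    change _ = _ • MvPolynomial.monomial _ _
    rw [MvPolynomial.smul_monomial, smul_eq_mul, mul_one]
  rw [hsum]
  refine T.sum_mem fun m _ => T.smul_mem _ ?_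
  by_cases hB : m.1 ∈ B
  · have h0 : monomialClass J hI ⟨m.1, hA m.1 m.2⟩ = 0 := by
      rw [monomialClass, Submodule.mkQ_apply, Submodule.Quotient.mk_eq_zero]
      refine (hJ _).2 fun n hn => ?_
      rw [Finset.mem_singleton.1 (MvPolynomial.support_monomial_subset hn)]
      exact hB
    rw [h0]
    exact T.zero_mem
  · exact hT _ m.2 hB

theorem free_span_singleton {S M : Type*} [Ring S] [AddCommGroup M] [Module S M] {u : M}
    (hu : Function.Injective (LinearMap.toSpanSingleton S M u)) :
    Module.Free S (Submodule.span S {u}) := by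
  rw [← LinearMap.range_toSpanSingleton]
  exact Module.Free.of_equiv (LinearEquiv.ofInjective _ hu)

/-- The cell avoids the exponent vectors of `J`, so no nonzero element of `𝕂[Z]` kills the class of
`x ^ c`. -/
theorem isStanleySpace_monomialClass (hI : ∀ f, f ∈ I ↔ ∀ m ∈ f.support, m ∈ A)
    (hJ : ∀ f, f ∈ J ↔ ∀ m ∈ f.support, m ∈ B) (c : A) (Z : Finset σ)
    (hcell : ∀ m ∈ exponentCell c.1 Z, m ∉ B) :
    IsStanleySpace (quotientComponent I J) (monomialClass J hI c) Z where
  homogeneous := by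
    refine ⟨fun i => (c.1 i : ℤ), _, fun m hm i => ?_, rfl⟩
    rw [Finset.mem_singleton.1 (MvPolynomial.support_monomial_subset hm)]
  ne_zero := (linearIndependent_monomialClass hI hJ).ne_zero
    (⟨c, hcell _ ⟨fun _ => le_rfl, fun _ _ => rfl⟩⟩ : {m : A // m.1 ∉ B})
  free := by
    have hinj : Function.Injective (LinearMap.toSpanSingleton
        (MvPolynomial.supported K (Z : Set σ)) (I ⧸ J.submoduleOf I) (monomialClass J hI c)) := by
      rw [← LinearMap.ker_eq_bot, LinearMap.ker_eq_bot']
      rintro ⟨p, hp⟩ h0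
      have h1 : p * MvPolynomial.monomial c.1 1 ∈ J :=
        (Submodule.Quotient.mk_eq_zero (J.submoduleOf I)).1 h0
      apply Subtype.ext
      change p = 0
      rw [← MvPolynomial.support_eq_empty, Finset.eq_empty_iff_forall_notMem]
      intro m hm
      refine hcell (m + c.1) (add_mem_exponentCell fun v hv =>
        eq_zero_of_mem_support_of_mem_supported hp hm hv) ((hJ _).1 h1 _ ?_)
      rw [MvPolynomial.mem_support_iff, MvPolynomial.coeff_mul_monomial, mul_one]
      exact MvPolynomial.mem_support_iff.1 hm
    exact free_span_singleton hinj

theorem stanleySpace_monomialClass (hI : ∀ f, f ∈ I ↔ ∀ m ∈ f.support, m ∈ A)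
    (hJ : ∀ f, f ∈ J ↔ ∀ m ∈ f.support, m ∈ B) (c : A) (Z : Finset σ) :
    (stanleySpace (K := K) (monomialClass J hI c) Z).restrictScalars K
      = Submodule.span K ((fun m : {m : A // m.1 ∉ B} => monomialClass J hI m.1) ''
          {m | m.1.1 ∈ exponentCell c.1 Z}) := by
  classical
  apply le_antisymm
  · intro x hx
    obtain ⟨⟨p, hp⟩, rfl⟩ := Submodule.mem_span_singleton.1 hx
    refine mkQ_mem_of_monomialClass_mem hI hJ
      (p • (⟨MvPolynomial.monomial c.1 1, _⟩ : I)) fun m hm hB => ?_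
    refine Submodule.subset_span ⟨⟨m, hB⟩, ?_, rfl⟩
    have hm' : m.1 ∈ (p * MvPolynomial.monomial c.1 1).support := hm
    rw [MvPolynomial.mem_support_iff, MvPolynomial.coeff_mul_monomial'] at hm'
    split_ifs at hm' with hle
    · obtain ⟨n, hn⟩ := exists_add_of_le hle
      rw [hn, add_tsub_cancel_left, mul_one] at hm'
      change m.1 ∈ exponentCell c.1 Z
      rw [hn, add_comm]
      exact add_mem_exponentCell fun v hv =>
        eq_zero_of_mem_support_of_mem_supported hp (MvPolynomial.mem_support_iff.2 hm') hv
    · exact absurd rfl hm'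
  · rw [Submodule.span_le]
    rintro _ ⟨m, ⟨hm1, hm2⟩, rfl⟩
    refine Submodule.mem_span_singleton.2 ⟨⟨MvPolynomial.monomial (m.1.1 - c.1) 1,
      monomial_mem_supported 1 fun v hv => by simp [hm2 v hv]⟩, ?_⟩
    have hle : c.1 ≤ m.1.1 := hm1
    refine congrArg (J.submoduleOf I).mkQ (Subtype.ext ?_)
    change MvPolynomial.monomial (m.1.1 - c.1) 1 * MvPolynomial.monomial c.1 1 = _
    rw [MvPolynomial.monomial_mul, tsub_add_cancel_of_le hle, one_mul]

/-- A partition of the exponent vectors of `I` outside `J` into cells `c + ℕ^Z` is a Stanley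
decomposition of `I / J`. -/
theorem le_stanleyDepth_of_partition (hI : ∀ f, f ∈ I ↔ ∀ m ∈ f.support, m ∈ A)
    (hJ : ∀ f, f ∈ J ↔ ∀ m ∈ f.support, m ∈ B) {l p : ℕ} (c : Fin l → σ →₀ ℕ)
    (Z : Fin l → Finset σ) (hp : ∀ j, p ≤ (Z j).card)
    (hsub : ∀ j, exponentCell (c j) (Z j) ⊆ A \ B)
    (hpart : ∀ m ∈ A \ B, ∃! j, m ∈ exponentCell (c j) (Z j)) :
    (p : ℕ∞) ≤ stanleyDepth (quotientComponent I J) := by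
  classical
  let g : Fin l → A := fun j => ⟨c j, (hsub j ⟨fun _ => le_rfl, fun _ _ => rfl⟩).1⟩
  let w : {m : A // m.1 ∉ B} → I ⧸ J.submoduleOf I := fun m => monomialClass J hI m.1
  let S : Fin l → Set {m : A // m.1 ∉ B} := fun j => {m | m.1.1 ∈ exponentCell (c j) (Z j)}
  have hspace : ∀ j, (stanleySpace (K := K) (monomialClass J hI (g j)) (Z j)).restrictScalars K
      = Submodule.span K (w '' S j) := fun j =>
    stanleySpace_monomialClass hI hJ (g j) (Z j)
  let D : StanleyDecomposition (quotientComponent I J) :=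
    { length := l
      gen := fun j => monomialClass J hI (g j)
      vars := Z
      isStanleySpace := fun j =>
        isStanleySpace_monomialClass hI hJ (g j) (Z j) fun m hm => (hsub j hm).2
      isInternal := by
        simp only [hspace]
        apply DirectSum.isInternal_submodule_of_iSupIndep_of_iSup_eq_top
        · intro i
          rw [← Submodule.span_iUnion₂, ← Set.image_iUnion₂]
          refine (linearIndependent_monomialClass hI hJ).disjoint_span_image ?_
          rw [Set.disjoint_iUnion₂_right]
          intro j hj
          rw [Set.disjoint_left]
          exact fun m hmi hmj => hj ((hpart m.1.1 ⟨m.1.2, m.2⟩).unique hmj hmi)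
        · rw [eq_top_iff]
          rintro x -
          obtain ⟨f, rfl⟩ := Submodule.mkQ_surjective _ x
          refine mkQ_mem_of_monomialClass_mem hI hJ f fun m _ hB => ?_
          obtain ⟨j, hj, -⟩ := hpart m.1 ⟨m.2, hB⟩
          exact Submodule.mem_iSup_of_mem j
            (Submodule.subset_span ⟨⟨m, hB⟩, hj, rfl⟩) }
  refine le_iSup_of_le D (le_iInf fun j => ?_)
  exact_mod_cast hp j

end Decomposition
/-! ### The lower bound for the Stanley depth -/

theorem theorem3p8 {K : Type*} [Field K] {V : Type*} [Finite V] (G : SimpleGraph V) (k : ℕ) :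
    (numBipartiteComponents G : ℕ∞) ≤
      stanleyDepth (quotientComponent (idealIntegralClosure (edgeIdeal K G ^ k))
        (idealIntegralClosure (edgeIdeal K G ^ (k + 1)))) := by
  have : Fintype V := Fintype.ofFinite V
  obtain ⟨l, c, Z, hp, hsub, hpart⟩ := exists_cell_partition G k
  refine le_stanleyDepth_of_partition
    (A := {m : V →₀ ℕ | 2 * k ≤ minCover G Finset.univ m})
    (B := {m : V →₀ ℕ | 2 * (k + 1) ≤ minCover G Finset.univ m})
    (fun f => mem_idealIntegralClosure_iff) (fun f => mem_idealIntegralClosure_iff)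
    (fun j => Finsupp.equivFunOnFinite.symm (c j)) Z hp ?_ ?_
  · intro j m hm
    obtain ⟨h1, h2⟩ := hsub j m hm.1 hm.2
    exact ⟨h1, h2.not_ge⟩
  · exact fun m hm => hpart m hm.1 (lt_of_not_ge hm.2)
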